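/- Let $F$ be a field, and let $\mathrm{Zar}(F)$ be the set of valuation rings of $F$, that is, of subrings $V\subseteq F$ such that $t\in V$ or $t^{-1}\in V$ for each $0\ne t\in F$; write $\mathfrak M_V$ for the maximal ideal of $V$. The patch topology on $\mathrm{Zar}(F)$ has as a basis the sets $\{V : x_1,\dots,x_n\in V,\ y_1,\dots,y_m\notin V\}$ with $n,m\ge 0$ and $x_i,y_j\in F$. For $X\subseteq\mathrm{Zar}(F)$ let $A(X)=\bigcap_{V\in X}V$ (with $A(\emptyset)=F$), and let $\lim(X)$ be the set of limit points of $X$ in $\mathrm{Zar}(F)$ for the patch topology. A valuation ring $V\in\mathrm{Zar}(F)$ dominates a local subring $A$ of $F$ with maximal ideal $M$ if $A\subseteq V$ and $M\subseteq\mathfrak M_V$. Theorem. Let $A$ be an integrally closed local subring of $F$ with quotient field $F$ and maximal ideal $M$. Suppose that $\mathrm{End}(M)=\{t\in F: tM\subseteq M\}$ equals $A$ and that $A$ is not a valuation ring. Let $X\subseteq\mathrm{Zar}(F)$ be such that $A=A(X)$ and all but finitely many valuation rings in $X$ dominate $A$. Then there is a subset $Z\subseteq\lim(X)$ such that $A=A(Z)$,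 $Z$ is perfect in the patch topology (every point of $Z$ is a patch limit point of $Z$), and every $V\in Z$ dominates $A$ and has residue field $V/\mathfrak M_V$ transcendental (i.e. not algebraic) over $A/M$. -/

import Mathlib

/-- The patch (constructible) topology on the set `Zar(F)` of all valuation rings of the field `F`:
it is generated by the sets of valuation rings `V` with `x₁, …, xₙ ∈ V` and `y₁, …, yₘ ∉ V`. -/
@[reducible] def patchTopology (F : Type*) [Field F] : TopologicalSpace (ValuationSubring F) :=
  TopologicalSpace.generateFrom
    {W | ∃ s t : Finset F,
      W = {V : ValuationSubring F | (∀ x ∈ s, x ∈ V) ∧ ∀ y ∈ t, y ∉ V}}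

/-- `lim(X)`: the set of limit points of `X` in the patch topology of `Zar(F)`. -/
def patchLim {F : Type*} [Field F] (X : Set (ValuationSubring F)) : Set (ValuationSubring F) :=
  @derivedSet (ValuationSubring F) (patchTopology F) X

/-- `X` is perfect in the patch topology: as a space, each of its points is a limit point.
It is not required that `X` is closed in `Zar(F)`. -/
def IsPatchPerfect {F : Type*} [Field F] (X : Set (ValuationSubring F)) : Prop :=
  @Preperfect (ValuationSubring F) (patchTopology F) X

/-- `A(X)`: the intersection of the valuation rings in `X`. -/
def interRing {F : Type*} [Field F] (X : Set (ValuationSubring F)) : Subring F :=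
  ⨅ V ∈ X, V.toSubring

/-- `End(J) = {t ∈ F : tJ ⊆ J}` for an ideal `J` of a subring `A` of `F`. -/
def idealEnd {F : Type*} [Field F] {A : Subring F} (J : Ideal A) : Set F :=
  {t : F | ∀ a ∈ J, ∃ b ∈ J, (b : F) = t * (a : F)}

/-- The inclusion homomorphism of a subring `A` of `F` into a valuation ring `V` containing it. -/
def inclToVal {F : Type*} [Field F] {A : Subring F} {V : ValuationSubring F}
    (h : A ≤ V.toSubring) : A →+* V :=
  A.subtype.codRestrict V (fun a => h a.2)

/-- `V` dominates the local subring `A` of `F`: `A ⊆ V`, and the maximal ideal of `A` is contained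
in the maximal ideal of `V`. -/
def Dominates {F : Type*} [Field F] (V : ValuationSubring F) (A : Subring F) [IsLocalRing A] :
    Prop :=
  ∃ h : A ≤ V.toSubring, ∀ a ∈ IsLocalRing.maximalIdeal A,
    inclToVal h a ∈ IsLocalRing.maximalIdeal V

theorem isLocalHom_inclToVal {F : Type*} [Field F] {A : Subring F} [IsLocalRing A]
    {V : ValuationSubring F} (h : Dominates V A) : IsLocalHom (inclToVal h.1) := by
  refine ⟨fun a ha => ?_⟩
  by_contra hn
  exact (IsLocalRing.mem_maximalIdeal _).1 (h.2 a ((IsLocalRing.mem_maximalIdeal _).2 hn)) ha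

/-- The homomorphism of residue fields `A/M → V/𝔐_V` induced by `A ⊆ V` when `V` dominates `A`. -/
noncomputable def residueMap {F : Type*} [Field F] {A : Subring F} [IsLocalRing A]
    {V : ValuationSubring F} (h : Dominates V A) :
    IsLocalRing.ResidueField A →+* IsLocalRing.ResidueField V :=
  haveI := isLocalHom_inclToVal h
  IsLocalRing.ResidueField.map (inclToVal h.1)

/-- The residue field of `V` is transcendental (that is, not algebraic) over the residue field of
the local ring `A` dominated by `V`. -/
def HasTranscendentalResidueField {F : Type*} [Field F] {A : Subring F} [IsLocalRing A]
    {V : ValuationSubring F} (h : Dominates V A) : Prop :=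
  @Algebra.Transcendental (IsLocalRing.ResidueField A) (IsLocalRing.ResidueField V) _ _
    (residueMap h).toAlgebra

/-! Discard the finitely many non-dominating rings (`interRing_diff_eq`), so that `A` is represented
by a set `Y` of dominating ones. If neither `y` nor its inverse lies in `A`, then for each monic `g`
over `A` infinitely many rings of `Y` have `y` and `g(y)` as units (`infinite_inter_unitLocus`).
`Zar(F)` is compact, so some limit point of `Y` does this for all `g` at once, and there the residue
of `y` is transcendental over `A/M`. Such limit points are plentiful enough to represent `A` again
(`interRing_transcendentalLim`).

To obtain a perfect set, Zorn's lemma and compactness give a minimal closed `C` inside the limit set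
that represents `A`. Both the limit set of `C` and the closure of its transcendental limit points
are closed subsets of `C` representing `A`, so both equal `C`. Hence the transcendental limit points
of `C` are dense in a perfect set, and so form a perfect set themselves. -/

open Filter Topology

attribute [local instance] patchTopology

/-! ### The patch topology is compact and Hausdorff. -/

section PatchTopology

variable {F : Type*} [Field F]

theorem isOpen_setOf_mem (x : F) : IsOpen {V : ValuationSubring F | x ∈ V} :=
  TopologicalSpace.isOpen_generateFrom_of_mem ⟨{x}, ∅, by simp⟩

theorem isOpen_setOf_notMem (x : F) : IsOpen {V : ValuationSubring F | x ∉ V} :=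
  TopologicalSpace.isOpen_generateFrom_of_mem ⟨∅, {x}, by simp⟩

theorem isClosed_setOf_mem (x : F) : IsClosed {V : ValuationSubring F | x ∈ V} :=
  ⟨isOpen_setOf_notMem x⟩

theorem isClosed_setOf_notMem (x : F) : IsClosed {V : ValuationSubring F | x ∉ V} :=
  (isOpen_setOf_mem x).isClosed_compl

instance t2Space_patchTopology : T2Space (ValuationSubring F) := by
  refine ⟨fun V W hVW => ?_⟩
  obtain ⟨x, hx⟩ : ∃ x, ¬ (x ∈ V ↔ x ∈ W) := by
    by_contra! h
    exact hVW (ValuationSubring.ext V W h)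
  by_cases hV : x ∈ V
  · exact ⟨_, _, isOpen_setOf_mem x, isOpen_setOf_notMem x, hV, fun hW => hx (by tauto),
      Set.disjoint_left.2 fun _ h h' => h' h⟩
  · exact ⟨_, _, isOpen_setOf_notMem x, isOpen_setOf_mem x, hV,
      by by_contra hW; exact hx (iff_of_false hV hW), Set.disjoint_left.2 fun _ h h' => h h'⟩

/-- The valuation ring of all elements that lie in almost all valuation rings with respect to an
ultrafilter. -/
def ultrafilterLimit (u : Ultrafilter (ValuationSubring F)) : ValuationSubring F where
  carrier := {x | ∀ᶠ W : ValuationSubring F in (u : Filter (ValuationSubring F)), x ∈ W}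
  zero_mem' := Eventually.of_forall fun W => W.zero_mem
  one_mem' := Eventually.of_forall fun W => W.one_mem
  add_mem' ha hb := by
    filter_upwards [ha, hb] with W h h' using W.add_mem _ _ h h'
  mul_mem' ha hb := by
    filter_upwards [ha, hb] with W h h' using W.mul_mem _ _ h h'
  neg_mem' ha := by
    filter_upwards [ha] with W h using W.neg_mem _ h
  mem_or_inv_mem' x := Ultrafilter.eventually_or.1 (Eventually.of_forall fun W => W.mem_or_inv_mem x)

theorem mem_ultrafilterLimit {u : Ultrafilter (ValuationSubring F)} {x : F} :
    x ∈ ultrafilterLimit u ↔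
      ∀ᶠ W : ValuationSubring F in (u : Filter (ValuationSubring F)), x ∈ W :=
  Iff.rfl

instance compactSpace_patchTopology : CompactSpace (ValuationSubring F) := by
  refine ⟨isCompact_iff_ultrafilter_le_nhds.2 fun u _ => ⟨ultrafilterLimit u, Set.mem_univ _, ?_⟩⟩
  rw [TopologicalSpace.nhds_generateFrom]
  refine le_iInf₂ fun U hU => le_principal_iff.2 ?_
  obtain ⟨hV, s, t, rfl⟩ := hU
  have h1 : ∀ᶠ W : ValuationSubring F in (u : Filter (ValuationSubring F)), ∀ x ∈ s, x ∈ W :=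
    (eventually_all_finset s).2 fun x hx => mem_ultrafilterLimit.1 (hV.1 x hx)
  have h2 : ∀ᶠ W : ValuationSubring F in (u : Filter (ValuationSubring F)), ∀ y ∈ t, y ∉ W :=
    (eventually_all_finset t).2 fun y hy =>
      Ultrafilter.eventually_not.2 fun h => hV.2 y hy (mem_ultrafilterLimit.2 h)
  exact h1.and h2

end PatchTopology

/-! ### Geometric sums and their values. -/

section GeomSum

/-- For distinct primes, `r ^ p = r ^ q = 1` forces `r = 1`; the sums are then `p` and `q`, which by
Bézout cannot both vanish in `κ`. -/
theorem eq_of_geomSum_eq_zero {κ : Type*} [Field κ] {r : κ} {p q : ℕ} (hp : p.Prime)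
    (hq : q.Prime) (h1 : ∑ i ∈ Finset.range p, r ^ i = 0) (h2 : ∑ i ∈ Finset.range q, r ^ i = 0) :
    p = q := by
  by_contra hne
  have hpq : Nat.Coprime p q := (Nat.coprime_primes hp hq).2 hne
  have e1 : r ^ p = 1 := by
    have := geom_sum_mul r p
    rw [h1, zero_mul] at this
    exact (sub_eq_zero.1 this.symm)
  have e2 : r ^ q = 1 := by
    have := geom_sum_mul r q
    rw [h2, zero_mul] at this
    exact (sub_eq_zero.1 this.symm)
  have e : r = 1 := by
    have : r ^ Nat.gcd p q = 1 := pow_gcd_eq_one.2 ⟨e1, e2⟩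
    rwa [hpq.gcd_eq_one, pow_one] at this
  subst e
  simp only [one_pow, Finset.sum_const, Finset.card_range, nsmul_eq_mul, mul_one] at h1 h2
  have hc := Nat.isCoprime_iff_coprime.2 hpq
  obtain ⟨a, b, hab⟩ := hc
  have := congrArg (Int.cast : ℤ → κ) hab
  push_cast at this
  rw [h1, h2] at this
  simp at this

variable {F : Type*} [Field F]

theorem valuation_geomSum_of_notMem {V : ValuationSubring F} {x : F} (hx : x ∉ V) (n : ℕ) :
    V.valuation (∑ i ∈ Finset.range (n + 1), x ^ i) = V.valuation x ^ n := by
  have hv : 1 < V.valuation x := not_le.1 fun h => hx ((V.valuation_le_one_iff x).1 h)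
  induction n with
  | zero => simp
  | succ n ih =>
    rw [Finset.sum_range_succ, Valuation.map_add_eq_of_lt_right, map_pow]
    rw [ih, map_pow]
    exact pow_lt_pow_right₀ hv (Nat.lt_succ_self n)

theorem subsingleton_setOf_prime_valuation_geomSum_lt_one (V : ValuationSubring F) {x : F}
    (hx : x ∈ V) :
    {p : ℕ | p.Prime ∧ V.valuation (∑ i ∈ Finset.range p, x ^ i) < 1}.Subsingleton := by
  have key : ∀ p : ℕ, V.valuation (∑ i ∈ Finset.range p, x ^ i) < 1 →
      ∑ i ∈ Finset.range p, (IsLocalRing.residue V ⟨x, hx⟩) ^ i = 0 := by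
    intro p hp
    have h : (∑ i ∈ Finset.range p, (⟨x, hx⟩ : V) ^ i) ∈ IsLocalRing.maximalIdeal V := by
      rw [ValuationSubring.valuation_lt_one_iff]
      simpa using hp
    have := (IsLocalRing.residue_eq_zero_iff _).2 h
    rw [map_sum] at this
    simpa only [map_pow] using this
  rintro p ⟨hp, hp'⟩ q ⟨hq, hq'⟩
  exact eq_of_geomSum_eq_zero hp hq (key p hp') (key q hq')

/-- A geometric sum of `x` can be chosen to have the largest possible value at each of finitely many
valuations. -/
theorem exists_geomSum_valuation_ge {S : Set (ValuationSubring F)} (hS : S.Finite) (x : F) :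
    ∃ n : ℕ, 2 ≤ n ∧ ∀ V ∈ S, ∀ j < n,
      V.valuation (x ^ j) ≤ V.valuation (∑ i ∈ Finset.range n, x ^ i) := by
  have hfin : (⋃ V ∈ S, {p : ℕ | x ∈ V ∧ p.Prime ∧
      V.valuation (∑ i ∈ Finset.range p, x ^ i) < 1}).Finite := by
    refine hS.biUnion fun V _ => ?_
    by_cases hx : x ∈ V
    · exact (subsingleton_setOf_prime_valuation_geomSum_lt_one V hx).finite.subset fun p hp => hp.2
    · simp [hx]
  -- Each valuation ring containing `x` excludes at most one prime; the others exclude none, since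
  -- there the top power dominates.
  obtain ⟨p, hp, hpn⟩ := Nat.infinite_setOfPred_prime.exists_notMem_finite hfin
  refine ⟨p, hp.two_le, fun V hV j hj => ?_⟩
  by_cases hx : x ∈ V
  · have h1 : 1 ≤ V.valuation (∑ i ∈ Finset.range p, x ^ i) := by
      by_contra! h
      exact hpn (Set.mem_iUnion₂.2 ⟨V, hV, hx, hp, h⟩)
    refine le_trans ?_ h1
    rw [map_pow]
    exact pow_le_one₀ zero_le ((V.valuation_le_one_iff x).2 hx)
  · obtain ⟨n, rfl⟩ : ∃ n, p = n + 1 := ⟨p - 1, (Nat.sub_add_cancel hp.one_le).symm⟩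
    rw [valuation_geomSum_of_notMem hx, map_pow]
    exact pow_le_pow_right₀ (not_le.1 fun h => hx ((V.valuation_le_one_iff x).1 h)).le
      (Nat.lt_succ_iff.1 hj)

end GeomSum

/-! ### Integrality and unit loci. -/

section LocalSubring

variable {F : Type*} [Field F] {A : Subring F}

theorem mem_interRing {X : Set (ValuationSubring F)} {x : F} :
    x ∈ interRing X ↔ ∀ V ∈ X, x ∈ V := by
  simp [interRing, Subring.mem_iInf]

theorem valuationRing_of_mem_or_inv_mem [IsFractionRing A F] (h : ∀ x : F, x ∈ A ∨ x⁻¹ ∈ A) :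
    ValuationRing A := by
  rw [ValuationRing.iff_isInteger_or_isInteger A F]
  intro x
  exact (h x).imp (fun hx => ⟨⟨x, hx⟩, rfl⟩) fun hx => ⟨⟨x⁻¹, hx⟩, rfl⟩

theorem mem_of_isIntegral [IsFractionRing A F] [IsIntegrallyClosed A] {x : F}
    (h : IsIntegral A x) : x ∈ A := by
  obtain ⟨a, rfl⟩ := IsIntegrallyClosed.isIntegral_iff.1 h
  exact a.2

theorem mem_of_aeval_mem [IsFractionRing A F] [IsIntegrallyClosed A] {x : F}
    {g : Polynomial A} (hg : g.Monic) (hdeg : g.natDegree ≠ 0) (h : Polynomial.aeval x g ∈ A) :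
    x ∈ A := by
  refine mem_of_isIntegral (IsIntegral.of_aeval_monic hg hdeg ?_)
  exact isIntegral_algebraMap (R := A) (A := F) (x := ⟨_, h⟩)

theorem aeval_mem_of_le {V : ValuationSubring F} (hV : ∀ a ∈ A, a ∈ V) {x : F} (hx : x ∈ V)
    (g : Polynomial A) : Polynomial.aeval x g ∈ V := by
  rw [Polynomial.aeval_eq_sum_range]
  refine sum_mem fun i _ => ?_
  rw [Algebra.smul_def]
  exact V.mul_mem _ _ (hV _ (g.coeff i).2) (pow_mem hx i)

theorem mem_of_aeval_mem_of_le {V : ValuationSubring F} (hV : ∀ a ∈ A, a ∈ V) {x : F}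
    {g : Polynomial A} (hg : g.Monic) (hdeg : g.natDegree ≠ 0) (h : Polynomial.aeval x g ∈ V) :
    x ∈ V := by
  have hx : IsIntegral V x := by
    let f : A →+* V := inclToVal hV
    refine IsIntegral.of_aeval_monic (hg.map f) (by rwa [hg.natDegree_map]) ?_
    have : Polynomial.aeval x (g.map f) = Polynomial.aeval x g := by
      rw [Polynomial.aeval_def, Polynomial.eval₂_map]
      rfl
    rw [this]
    exact isIntegral_algebraMap (R := V) (A := F) (x := ⟨_, h⟩)
  obtain ⟨a, rfl⟩ := IsIntegrallyClosed.isIntegral_iff.1 hx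
  exact a.2

variable (A) in
/-- The valuation rings that contain both `y` and the inverse of `y * g(y)`. -/
def unitLocus (y : F) (g : Polynomial A) : Set (ValuationSubring F) :=
  {V | y ∈ V ∧ (Polynomial.aeval y (Polynomial.X * g))⁻¹ ∈ V}

theorem isClosed_unitLocus (y : F) (g : Polynomial A) : IsClosed (unitLocus A y g) :=
  (isClosed_setOf_mem y).inter (isClosed_setOf_mem _)

theorem aeval_ne_zero_of_notMem [IsFractionRing A F] [IsIntegrallyClosed A] {y : F} (hy : y ∉ A)
    {g : Polynomial A} (hg : g.Monic) :
    Polynomial.aeval y g ≠ 0 :=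
  fun h => hy (mem_of_isIntegral ⟨g, hg, h⟩)

/-- This makes the loci a directed family under multiplication of polynomials, as the compactness
argument needs. -/
theorem mem_unitLocus_of_mul [IsFractionRing A F] [IsIntegrallyClosed A] {y : F} (hy : y ∉ A)
    {g h : Polynomial A} (hh : h.Monic)
    {V : ValuationSubring F} (hVA : ∀ a ∈ A, a ∈ V) (hV : V ∈ unitLocus A y (g * h)) :
    V ∈ unitLocus A y g := by
  refine ⟨hV.1, ?_⟩
  have h0 := aeval_ne_zero_of_notMem hy hh
  have := V.mul_mem _ _ hV.2 (aeval_mem_of_le hVA hV.1 h)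
  rwa [← mul_assoc, map_mul _ _ h, mul_inv, mul_assoc, inv_mul_cancel₀ h0, mul_one] at this

/-! ### Domination and closed representations. -/

variable [IsLocalRing A]

theorem dominates_iff {V : ValuationSubring F} :
    Dominates V A ↔ (∀ a ∈ A, a ∈ V) ∧
      ∀ a ∈ IsLocalRing.maximalIdeal A, V.valuation (a : F) < 1 := by
  constructor
  · rintro ⟨h, h'⟩
    exact ⟨h, fun a ha => (V.valuation_lt_one_iff _).1 (h' a ha)⟩
  · rintro ⟨h, h'⟩
    exact ⟨h, fun a ha => (V.valuation_lt_one_iff _).2 (h' a ha)⟩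

theorem mem_maximalIdeal_of_inv_notMem {a : F} (ha : a ∈ A) (h : a⁻¹ ∉ A) :
    (⟨a, ha⟩ : A) ∈ IsLocalRing.maximalIdeal A := by
  rw [IsLocalRing.mem_maximalIdeal]
  intro hu
  obtain ⟨b, hb⟩ := hu.exists_right_inv
  have : a * b = 1 := congrArg Subtype.val hb
  exact h (by rw [inv_eq_of_mul_eq_one_right this]; exact b.2)

theorem inv_mem_of_dominates {V : ValuationSubring F} (hV : Dominates V A) {a : F} (ha : a ∈ A)
    (h : 1 ≤ V.valuation a) : a⁻¹ ∈ A := by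
  by_contra hn
  exact absurd ((dominates_iff.1 hV).2 _ (mem_maximalIdeal_of_inv_notMem ha hn)) (not_lt.2 h)

/-- A nonzero `a` is a nonunit of `V` exactly when `a⁻¹ ∉ V`, a closed condition. Zero must be left
out because `0⁻¹ = 0`. -/
theorem isClosed_setOf_dominates : IsClosed {V : ValuationSubring F | Dominates V A} := by
  have : {V : ValuationSubring F | Dominates V A} =
      (⋂ a ∈ A, {V : ValuationSubring F | a ∈ V}) ∩
        ⋂ a ∈ {a : A | a ∈ IsLocalRing.maximalIdeal A ∧ (a : F) ≠ 0},
          {V : ValuationSubring F | (a : F)⁻¹ ∉ V} := by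
    ext V
    simp only [Set.mem_ofPred_eq, dominates_iff, Set.mem_inter_iff, Set.mem_iInter]
    refine and_congr_right fun _ => ?_
    simp only [← ValuationSubring.mem_nonunits_iff, ValuationSubring.mem_nonunits_iff_or]
    exact ⟨fun h a ha => (h a ha.1).resolve_left ha.2,
      fun h a ha => or_iff_not_imp_left.2 fun h0 => h a ⟨ha, h0⟩⟩
  rw [this]
  exact (isClosed_biInter fun a _ => isClosed_setOf_mem a).inter
    (isClosed_biInter fun a _ => isClosed_setOf_notMem _)

/-- A local ring that is an intersection of finitely many valuation rings is a valuation ring. -/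
theorem mem_or_inv_mem_of_finite {S : Set (ValuationSubring F)} (hS : S.Finite)
    (h : interRing S = A) (x : F) : x ∈ A ∨ x⁻¹ ∈ A := by
  rcases S.eq_empty_or_nonempty with rfl | ⟨V₀, hV₀⟩
  · left
    rw [← h, mem_interRing]
    simp
  obtain ⟨n, hn, hV⟩ := exists_geomSum_valuation_ge hS x
  set f := ∑ i ∈ Finset.range n, x ^ i with hf
  have hf0 : f ≠ 0 := by
    intro h0
    have := hV V₀ hV₀ 0 (by omega)
    rw [h0] at this
    simp at this
  have hmem : ∀ j < n, x ^ j * f⁻¹ ∈ A := by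
    intro j hj
    rw [← h, mem_interRing]
    intro V hVS
    rw [← V.valuation_le_one_iff, map_mul, map_inv₀]
    exact mul_inv_le_one_of_le₀ (hV V hVS j hj) zero_le
  -- The elements `x ^ j / f` of `A` add up to 1, so one is a unit; dividing a neighbouring one by
  -- it gives `x` or `x⁻¹`.
  obtain ⟨j, hj, hu⟩ : ∃ j < n, (x ^ j * f⁻¹)⁻¹ ∈ A := by
    by_contra! hno
    have hsum : ∑ j ∈ (Finset.range n).attach,
        (⟨x ^ (j : ℕ) * f⁻¹, hmem j (Finset.mem_range.1 j.2)⟩ : A) = 1 := by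
      apply Subtype.ext
      rw [AddSubmonoidClass.coe_finsetSum]
      simp only
      rw [Finset.sum_attach (Finset.range n) (fun j => x ^ j * f⁻¹), ← Finset.sum_mul, ← hf,
        mul_inv_cancel₀ hf0]
      rfl
    refine (Ideal.ne_top_iff_one _).1 (IsLocalRing.maximalIdeal.isMaximal A).ne_top ?_
    rw [← hsum]
    exact sum_mem fun j _ => mem_maximalIdeal_of_inv_notMem _ (hno j (Finset.mem_range.1 j.2))
  rcases eq_or_ne x 0 with rfl | hx
  · exact Or.inl A.zero_mem
  by_cases hjn : j + 1 < n
  · left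
    have := A.mul_mem (hmem (j + 1) hjn) hu
    have e : x ^ (j + 1) * f⁻¹ * (x ^ j * f⁻¹)⁻¹ = x := by
      field_simp
      ring
    rwa [e] at this
  · right
    obtain ⟨i, rfl⟩ : ∃ i, j = i + 1 := ⟨j - 1, by omega⟩
    have := A.mul_mem (hmem i (by omega)) hu
    have e : x ^ i * f⁻¹ * (x ^ (i + 1) * f⁻¹)⁻¹ = x⁻¹ := by
      field_simp
      ring
    rwa [e] at this

theorem exists_mul_notMem_maximalIdeal
    (hEnd : idealEnd (IsLocalRing.maximalIdeal A) = (A : Set F)) {t : F} (ht : t ∉ A) :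
    ∃ m ∈ IsLocalRing.maximalIdeal A, ∀ b ∈ IsLocalRing.maximalIdeal A, (b : F) ≠ t * m := by
  by_contra! h
  exact ht (hEnd.subset h)

theorem dominates_of_mem_derivedSet {Y : Set (ValuationSubring F)}
    (hdom : ∀ V ∈ Y, Dominates V A) {V : ValuationSubring F} (hV : V ∈ derivedSet Y) :
    Dominates V A :=
  closure_minimal (t := {V : ValuationSubring F | Dominates V A}) hdom isClosed_setOf_dominates
    (derivedSet_subset_closure _ hV)

theorem interRing_eq_of_subset {Z C : Set (ValuationSubring F)} (hZC : Z ⊆ C)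
    (hZ : interRing Z = A) (hC : ∀ V ∈ C, Dominates V A) : interRing C = A := by
  refine le_antisymm (fun x hx => ?_) fun x hx => ?_
  · rw [← hZ, mem_interRing]
    exact fun V hV => mem_interRing.1 hx V (hZC hV)
  · exact mem_interRing.2 fun V hV => (hC V hV).1 hx

/-- Among the closed sets of dominating valuation rings that represent `A` and are contained in a
given one, there is a minimal one. -/
theorem exists_minimal_isClosed_interRing_eq {C₀ : Set (ValuationSubring F)} (hC₀ : IsClosed C₀)
    (hdom : ∀ V ∈ C₀, Dominates V A) (h₀ : interRing C₀ = A) :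
    ∃ C ⊆ C₀, IsClosed C ∧ interRing C = A ∧
      ∀ D ⊆ C, IsClosed D → interRing D = A → D = C := by
  have hchain : ∀ c ⊆ {C : Set (ValuationSubring F) | IsClosed C ∧ C ⊆ C₀ ∧ interRing C = A},
      IsChain (· ⊆ ·) c → c.Nonempty →
        ∃ D ∈ {C : Set (ValuationSubring F) | IsClosed C ∧ C ⊆ C₀ ∧ interRing C = A},
          ∀ C ∈ c, D ⊆ C := by
    rintro c hc hchain ⟨B, hB⟩
    refine ⟨⋂₀ c, ⟨isClosed_sInter fun C hC => (hc hC).1,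
      (Set.sInter_subset_of_mem hB).trans (hc hB).2.1, ?_⟩, fun C hC => Set.sInter_subset_of_mem hC⟩
    refine le_antisymm (fun x hx => ?_) fun x hx => mem_interRing.2 fun V hV =>
      (hdom V ((hc hB).2.1 (hV B hB))).1 hx
    by_contra hxA
    have : Nonempty c := ⟨⟨B, hB⟩⟩
    -- The rings of `C` that omit `x` form nonempty nested compact sets, so some ring in the
    -- intersection of the chain omits `x`.
    have hcl : ∀ C : c, IsClosed (C.1 ∩ {V : ValuationSubring F | x ∉ V}) := fun C =>
      (hc C.2).1.inter (isClosed_setOf_notMem x)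
    have hdir : Directed (· ⊇ ·) fun C : c => C.1 ∩ {V : ValuationSubring F | x ∉ V} := by
      intro C D
      rcases hchain.total C.2 D.2 with h | h
      · exact ⟨C, subset_rfl, Set.inter_subset_inter_left _ h⟩
      · exact ⟨D, Set.inter_subset_inter_left _ h, subset_rfl⟩
    have hne : ∀ C : c, (C.1 ∩ {V : ValuationSubring F | x ∉ V}).Nonempty := by
      intro C
      by_contra hemp
      refine hxA ?_
      rw [← (hc C.2).2.2, mem_interRing]
      intro V hV
      by_contra hxV
      exact hemp ⟨V, hV, hxV⟩
    obtain ⟨W, hW⟩ := IsCompact.nonempty_iInter_of_directed_nonempty_isCompact_isClosed _ hdir hne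
      (fun C => (hcl C).isCompact) hcl
    rw [Set.mem_iInter] at hW
    exact (hW ⟨B, hB⟩).2 (mem_interRing.1 hx W fun C hC => (hW ⟨C, hC⟩).1)
  obtain ⟨C, hCC₀, hC⟩ := zorn_superset_nonempty _ hchain C₀ ⟨hC₀, subset_rfl, h₀⟩
  refine ⟨C, hCC₀, hC.prop.1, hC.prop.2.2, fun D hDC hD hDA => ?_⟩
  exact hC.eq_of_subset ⟨hD, hDC.trans hCC₀, hDA⟩ hDC

variable (A) in
/-- The limit points of `Y` that dominate `A` and whose residue field is transcendental over that of
`A`. -/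
def transcendentalLim (Y : Set (ValuationSubring F)) : Set (ValuationSubring F) :=
  {W ∈ derivedSet Y | ∃ h : Dominates W A, HasTranscendentalResidueField h}

/-! ### Removing finitely many rings, and transcendental limit points. -/

variable [IsFractionRing A F] [IsIntegrallyClosed A]

/-- Finitely many valuation rings may be omitted from a representation of `A` if the remaining ones
dominate `A` and `A = End(M)`. -/
theorem interRing_diff_eq (hEnd : idealEnd (IsLocalRing.maximalIdeal A) = (A : Set F))
    (hA : ¬ ValuationRing A) {X S : Set (ValuationSubring F)} (hX : interRing X = A)
    (hS : S.Finite) (hdom : ∀ V ∈ X \ S, Dominates V A) : interRing (X \ S) = A := by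
  refine le_antisymm (fun t ht => ?_) fun t ht => ?_
  swap
  · rw [← hX, mem_interRing] at ht
    exact mem_interRing.2 fun V hV => ht V hV.1
  rw [mem_interRing] at ht
  by_contra htA
  obtain ⟨V₀, hV₀⟩ : (X \ S).Nonempty := by
    by_contra hne
    have hfin : X.Finite := hS.subset (Set.sdiff_eq_empty.1 (Set.not_nonempty_iff_eq_empty.1 hne))
    exact hA (valuationRing_of_mem_or_inv_mem (mem_or_inv_mem_of_finite hfin hX))
  -- Multiplying by `m` makes `t * m` a nonunit at every remaining ring, so `f = 1 + t * m + ...` is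
  -- a unit there, while `f⁻¹` also lies in the rings of `S`. Thus `f` is a unit of `A` and `t * m`
  -- is integral over `A`.
  obtain ⟨m, hm, hmt⟩ := exists_mul_notMem_maximalIdeal hEnd htA
  have hlt : ∀ V ∈ X \ S, V.valuation (t * m) < 1 := by
    intro V hV
    rw [map_mul]
    exact mul_lt_one_of_nonneg_of_lt_one_right ((V.valuation_le_one_iff _).2 (ht V hV))
      zero_le ((dominates_iff.1 (hdom V hV)).2 m hm)
  obtain ⟨n, hn, hv⟩ := exists_geomSum_valuation_ge hS (t * m)
  set f := ∑ i ∈ Finset.range n, (t * (m : F)) ^ i with hf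
  have hone : ∀ V ∈ X \ S, V.valuation f = 1 := by
    intro V hV
    obtain ⟨k, rfl⟩ : ∃ k, n = k + 1 := ⟨n - 1, by omega⟩
    rw [hf, Finset.sum_range_succ', pow_zero, add_comm]
    refine Valuation.map_one_add_of_lt _ (Valuation.map_sum_lt _ one_ne_zero fun i _ => ?_)
    rw [map_pow]
    exact pow_lt_one₀ zero_le (hlt V hV) (by omega)
  have hfA : f⁻¹ ∈ A := by
    rw [← hX, mem_interRing]
    intro V hV
    rw [← V.valuation_le_one_iff, map_inv₀]
    by_cases hVS : V ∈ S
    · have := hv V hVS 0 (by omega)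
      rw [pow_zero, map_one] at this
      exact inv_le_one_of_one_le₀ this
    · rw [hone V ⟨hV, hVS⟩, inv_one]
  have hfA' : f ∈ A := by
    have := inv_mem_of_dominates (hdom V₀ hV₀) hfA (by rw [map_inv₀, hone V₀ hV₀, inv_one])
    rwa [inv_inv] at this
  have hxA : t * (m : F) ∈ A := by
    refine mem_of_aeval_mem (g := ∑ i ∈ Finset.range n, (Polynomial.X : Polynomial A) ^ i)
      (Polynomial.monic_geom_sum_X (by omega)) ?_ (by simpa [hf] using hfA')
    have h1 : (∑ i ∈ Finset.range n, (Polynomial.X : Polynomial A) ^ i).coeff 1 ≠ 0 := by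
      simp [Polynomial.coeff_X_pow]
      omega
    have := Polynomial.le_natDegree_of_ne_zero h1
    omega
  refine hmt ⟨_, hxA⟩ (mem_maximalIdeal_of_inv_notMem hxA fun hinv => ?_) rfl
  have h1 := (V₀.valuation_le_one_iff _).2 ((dominates_iff.1 (hdom V₀ hV₀)).1 _ hinv)
  have h2 := hlt V₀ hV₀
  rcases eq_or_ne (t * (m : F)) 0 with h0 | h0
  · exact hmt 0 (zero_mem _) (by simp [h0])
  · rw [map_inv₀] at h1
    exact absurd ((inv_le_one₀ (zero_lt_iff.2 ((Valuation.ne_zero_iff _).2 h0))).1 h1)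
      (not_le.2 h2)

/-- Otherwise drop these rings. At those left, `w = y * g(y)` has value below 1 if `y ∈ V` and above
1 if not, so `(1 + w)⁻¹ ∈ A`. If this is a unit of `A`, then `y` is integral over `A`; if it lies in
`M`, no remaining ring contains `y`, so all contain `y⁻¹`. The factor `X` keeps the degree positive
even for `g = 1`. -/
theorem infinite_inter_unitLocus (hEnd : idealEnd (IsLocalRing.maximalIdeal A) = (A : Set F))
    (hA : ¬ ValuationRing A) {Y : Set (ValuationSubring F)} (hY : interRing Y = A)
    (hdom : ∀ V ∈ Y, Dominates V A) {y : F} (hy : y ∉ A) (hy' : y⁻¹ ∉ A) {g : Polynomial A}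
    (hg : g.Monic) : (Y ∩ unitLocus A y g).Infinite := by
  intro hfin
  have hdom' : ∀ V ∈ Y \ (Y ∩ unitLocus A y g), Dominates V A := fun V hV => hdom V hV.1
  have hA' := interRing_diff_eq hEnd hA hY hfin hdom'
  set Y' := Y \ (Y ∩ unitLocus A y g)
  have hXg : (Polynomial.X * g).Monic := Polynomial.monic_X.mul hg
  have hdeg : (Polynomial.X * g).natDegree ≠ 0 := by
    rw [Polynomial.natDegree_X_mul hg.ne_zero]
    omega
  set w := Polynomial.aeval y (Polynomial.X * g) with hw
  have hw0 : w ≠ 0 := aeval_ne_zero_of_notMem hy hXg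
  have hne : ∀ V ∈ Y', y ∈ V → V.valuation w < 1 := by
    intro V hV hyV
    have hn : w⁻¹ ∉ V := fun h => hV.2 ⟨hV.1, hyV, h⟩
    exact V.mem_nonunits_iff.1 (V.mem_nonunits_iff_or.2 (Or.inr hn))
  have hgt : ∀ V ∈ Y', y ∉ V → 1 < V.valuation w := by
    intro V hV hyV
    by_contra! h
    exact hyV (mem_of_aeval_mem_of_le (dominates_iff.1 (hdom' V hV)).1 hXg hdeg
      ((V.valuation_le_one_iff _).1 h))
  have hv1 : ∀ V ∈ Y', y ∈ V → V.valuation (1 + w) = 1 := fun V hV hyV =>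
    Valuation.map_one_add_of_lt _ (hne V hV hyV)
  have hv2 : ∀ V ∈ Y', y ∉ V → V.valuation (1 + w) = V.valuation w := fun V hV hyV =>
    Valuation.map_add_eq_of_lt_right _ (by rw [map_one]; exact hgt V hV hyV)
  have he : (1 + w)⁻¹ ∈ A := by
    rw [← hA', mem_interRing]
    intro V hV
    rw [← V.valuation_le_one_iff, map_inv₀]
    by_cases hyV : y ∈ V
    · rw [hv1 V hV hyV, inv_one]
    · rw [hv2 V hV hyV]
      exact inv_le_one_of_one_le₀ (hgt V hV hyV).le
  by_cases he' : 1 + w ∈ A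
  · refine hy (mem_of_aeval_mem hXg hdeg ?_)
    have := A.sub_mem he' A.one_mem
    rwa [add_sub_cancel_left] at this
  · have hM := mem_maximalIdeal_of_inv_notMem he (by rwa [inv_inv])
    refine hy' ?_
    rw [← hA', mem_interRing]
    intro V hV
    have hlt := (dominates_iff.1 (hdom' V hV)).2 _ hM
    refine (V.mem_or_inv_mem y).resolve_left fun hyV => ?_
    simp [map_inv₀, hv1 V hV hyV] at hlt

theorem exists_mem_derivedSet_unitLocus
    (hEnd : idealEnd (IsLocalRing.maximalIdeal A) = (A : Set F))
    (hA : ¬ ValuationRing A) {Y : Set (ValuationSubring F)} (hY : interRing Y = A)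
    (hdom : ∀ V ∈ Y, Dominates V A) {y : F} (hy : y ∉ A) (hy' : y⁻¹ ∉ A) :
    ∃ W ∈ derivedSet Y, ∀ g : Polynomial A, g.Monic → W ∈ unitLocus A y g := by
  have : Nonempty {g : Polynomial A // g.Monic} := ⟨⟨1, Polynomial.monic_one⟩⟩
  have hdir : Directed (· ⊇ ·)
      fun g : {g : Polynomial A // g.Monic} => derivedSet (Y ∩ unitLocus A y g.1) := by
    intro g h
    refine ⟨⟨g.1 * h.1, g.2.mul h.2⟩, derivedSet_mono _ _ fun V hV => ⟨hV.1, ?_⟩,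
      derivedSet_mono _ _ fun V hV => ⟨hV.1, ?_⟩⟩
    · exact mem_unitLocus_of_mul hy h.2 (dominates_iff.1 (hdom V hV.1)).1 hV.2
    · have : V ∈ unitLocus A y (h.1 * g.1) := mul_comm g.1 h.1 ▸ hV.2
      exact mem_unitLocus_of_mul hy g.2 (dominates_iff.1 (hdom V hV.1)).1 this
  obtain ⟨W, hW⟩ := IsCompact.nonempty_iInter_of_directed_nonempty_isCompact_isClosed _ hdir
    (fun g => (infinite_inter_unitLocus hEnd hA hY hdom hy hy' g.2).exists_accPt_principal)
    (fun g => (isClosed_derivedSet _).isCompact) (fun g => isClosed_derivedSet _)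
  rw [Set.mem_iInter] at hW
  refine ⟨W, derivedSet_mono _ _ Set.inter_subset_left (hW ⟨1, Polynomial.monic_one⟩),
    fun g hg => ?_⟩
  exact (isClosed_unitLocus y g).closure_subset_iff.2 Set.inter_subset_right
    (derivedSet_subset_closure _ (hW ⟨g, hg⟩))

/-- An algebraic relation for the residue of `y`, made monic, lifts to a monic `g` over `A` with
`g(y)` a nonunit of `W`, against the unit locus condition. -/
theorem hasTranscendentalResidueField_of_mem_unitLocus {W : ValuationSubring F}
    (hW : Dominates W A) {y : F} (hy : y ∉ A)
    (h : ∀ g : Polynomial A, g.Monic → W ∈ unitLocus A y g) :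
    HasTranscendentalResidueField hW := by
  have hyW : y ∈ W := (h 1 Polynomial.monic_one).1
  let _ := (residueMap hW).toAlgebra
  refine ⟨IsLocalRing.residue W ⟨y, hyW⟩, transcendental_iff.2 fun p hp => ?_⟩
  by_contra hp0
  obtain ⟨g, hgp, -, hg⟩ := Polynomial.lifts_and_degree_eq_and_monic
    (f := IsLocalRing.residue A) (p := p * Polynomial.C p.leadingCoeff⁻¹)
    ((Polynomial.mem_lifts _).2 (Polynomial.map_surjective _ IsLocalRing.residue_surjective _))
    (Polynomial.monic_mul_leadingCoeff_inv hp0)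
  have h0 : Polynomial.aeval (IsLocalRing.residue W ⟨y, hyW⟩)
      (g.map (IsLocalRing.residue A)) = 0 := by
    rw [hgp, map_mul, hp, zero_mul]
  have h1 : IsLocalRing.residue W (g.eval₂ (inclToVal hW.1) ⟨y, hyW⟩) = 0 := by
    rw [Polynomial.hom_eval₂, ← h0, Polynomial.aeval_def, Polynomial.eval₂_map]
    rfl
  have h2 : ((g.eval₂ (inclToVal hW.1) ⟨y, hyW⟩ : W) : F) = Polynomial.aeval y g := by
    change W.subtype _ = _
    rw [Polynomial.hom_eval₂]
    rfl
  have h3 : W.valuation (Polynomial.aeval y g) < 1 := by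
    rw [← h2, ← W.valuation_lt_one_iff]
    exact (IsLocalRing.residue_eq_zero_iff _).1 h1
  have h4 := (W.valuation_le_one_iff _).2 (h g hg).2
  have h5 : W.valuation (Polynomial.aeval y (Polynomial.X * g)) < 1 := by
    rw [map_mul, map_mul, Polynomial.aeval_X]
    exact mul_lt_one_of_nonneg_of_lt_one_right ((W.valuation_le_one_iff _).2 hyW) zero_le h3
  have h6 : W.valuation (Polynomial.aeval y (Polynomial.X * g)) ≠ 0 :=
    (Valuation.ne_zero_iff _).2 (aeval_ne_zero_of_notMem hy (Polynomial.monic_X.mul hg))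
  rw [map_inv₀] at h4
  exact absurd ((inv_le_one₀ (zero_lt_iff.2 h6)).1 h4) (not_le.2 h5)

theorem exists_mem_transcendentalLim
    (hEnd : idealEnd (IsLocalRing.maximalIdeal A) = (A : Set F))
    (hA : ¬ ValuationRing A) {Y : Set (ValuationSubring F)} (hY : interRing Y = A)
    (hdom : ∀ V ∈ Y, Dominates V A) {y : F} (hy : y ∉ A) (hy' : y⁻¹ ∉ A) :
    ∃ W ∈ transcendentalLim A Y, y⁻¹ ∈ W := by
  obtain ⟨W, hWY, hW⟩ := exists_mem_derivedSet_unitLocus hEnd hA hY hdom hy hy'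
  have hd := dominates_of_mem_derivedSet hdom hWY
  refine ⟨W, ⟨hWY, hd, hasTranscendentalResidueField_of_mem_unitLocus hd hy hW⟩, ?_⟩
  simpa using (hW 1 Polynomial.monic_one).2

theorem interRing_transcendentalLim
    (hEnd : idealEnd (IsLocalRing.maximalIdeal A) = (A : Set F))
    (hA : ¬ ValuationRing A) {Y : Set (ValuationSubring F)} (hY : interRing Y = A)
    (hdom : ∀ V ∈ Y, Dominates V A) : interRing (transcendentalLim A Y) = A := by
  refine le_antisymm (fun x hx => ?_) fun x hx => mem_interRing.2 fun V hV => hV.2.choose.1 hx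
  rw [mem_interRing] at hx
  by_contra hxA
  by_cases hxi : x⁻¹ ∈ A
  -- Here `x⁻¹ ∈ M`, so any dominating ring omits `x`; `y` serves only to produce one in the set.
  · obtain ⟨y, hy, hy'⟩ : ∃ y : F, y ∉ A ∧ y⁻¹ ∉ A := by
      by_contra! h
      exact hA (valuationRing_of_mem_or_inv_mem fun y => or_iff_not_imp_left.2 (h y))
    obtain ⟨W, hW, -⟩ := exists_mem_transcendentalLim hEnd hA hY hdom hy hy'
    have hM := mem_maximalIdeal_of_inv_notMem hxi (by rwa [inv_inv])
    have hlt := (dominates_iff.1 hW.2.choose).2 _ hM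
    rcases W.inv_mem_nonunits_iff.1 (W.mem_nonunits_iff.2 hlt) with rfl | h
    · exact hxA A.zero_mem
    · exact h (hx W hW)
  -- The value of `x` at `W` is only known to be at most 1. The factor `m` makes it strictly smaller
  -- for `y = x * m`, contradicting `y⁻¹ ∈ W`.
  · obtain ⟨m, hm, hmx⟩ := exists_mul_notMem_maximalIdeal hEnd hxA
    have hm0 : (m : F) ≠ 0 := fun h => hmx 0 (zero_mem _) (by simp [h])
    have hy' : (x * (m : F))⁻¹ ∉ A := by
      intro h
      have := A.mul_mem h m.2
      rw [mul_inv, mul_assoc, inv_mul_cancel₀ hm0, mul_one] at this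
      exact hxi this
    have hy : x * (m : F) ∉ A := fun h =>
      hmx ⟨_, h⟩ (mem_maximalIdeal_of_inv_notMem h hy') rfl
    obtain ⟨W, hW, hyW⟩ := exists_mem_transcendentalLim hEnd hA hY hdom hy hy'
    have hlt : W.valuation (x * (m : F)) < 1 := by
      rw [map_mul]
      exact mul_lt_one_of_nonneg_of_lt_one_right ((W.valuation_le_one_iff _).2 (hx W hW)) zero_le
        ((dominates_iff.1 hW.2.choose).2 m hm)
    rcases W.mem_nonunits_iff_or.1 (W.mem_nonunits_iff.2 hlt) with h | h
    · exact hy (h ▸ A.zero_mem)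
    · exact h hyW

end LocalSubring

theorem theorem3p11 {F : Type*} [Field F] (A : Subring F) [IsLocalRing A] [IsFractionRing A F]
    [IsIntegrallyClosed A]
    (hEnd : idealEnd (IsLocalRing.maximalIdeal A) = (A : Set F))
    (hA : ¬ ValuationRing A)
    (X : Set (ValuationSubring F)) (hX : interRing X = A)
    (hdom : {V ∈ X | ¬ Dominates V A}.Finite) :
    ∃ Z : Set (ValuationSubring F),
      Z ⊆ patchLim X ∧ interRing Z = A ∧ IsPatchPerfect Z ∧
      ∀ V ∈ Z, ∃ h : Dominates V A, HasTranscendentalResidueField h := by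
  have hdom' : ∀ V ∈ X \ {V ∈ X | ¬ Dominates V A}, Dominates V A := fun V hV =>
    not_not.1 fun h => hV.2 ⟨hV.1, h⟩
  have hX' := interRing_diff_eq hEnd hA hX hdom hdom'
  set X' := X \ {V ∈ X | ¬ Dominates V A}
  have hdomlim : ∀ V ∈ derivedSet X', Dominates V A := fun V hV =>
    dominates_of_mem_derivedSet hdom' hV
  obtain ⟨C, hCX, hC, hCA, hmin⟩ := exists_minimal_isClosed_interRing_eq
    (isClosed_derivedSet X') hdomlim
    (interRing_eq_of_subset (fun V hV => hV.1) (interRing_transcendentalLim hEnd hA hX' hdom')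
      hdomlim)
  have hCdom : ∀ V ∈ C, Dominates V A := fun V hV => hdomlim V (hCX hV)
  have hZA := interRing_transcendentalLim hEnd hA hCA hCdom
  have hlim : derivedSet C ⊆ C := (isClosed_iff_derivedSet_subset C).1 hC
  have hZC : transcendentalLim A C ⊆ C := fun V hV => hlim hV.1
  have hCperf : derivedSet C = C := hmin _ hlim (isClosed_derivedSet C)
    (interRing_eq_of_subset (fun V hV => hV.1) hZA fun V hV => hCdom V (hlim hV))
  have hcl : closure (transcendentalLim A C) ⊆ C := closure_minimal hZC hC
  have hclosure : closure (transcendentalLim A C) = C := hmin _ hcl isClosed_closure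
    (interRing_eq_of_subset subset_closure hZA fun V hV => hCdom V (hcl hV))
  refine ⟨transcendentalLim A C, fun V hV => ?_, hZA, ?_, fun V hV => hV.2⟩
  · exact derivedSet_mono _ _ Set.sdiff_subset (hCX (hZC hV))
  -- A set is preperfect as soon as its closure is perfect, and here the closure is `C`.
  · refine preperfect_iff_perfect_closure.2 ?_
    rw [hclosure]
    exact perfect_iff_eq_derivedSet.2 hCperf.symm
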